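/- Let $Q_0=[0,1)$ with Lebesgue measure and let $\mathcal D(Q_0)$ be the collection of dyadic intervals $[j2^{-k},(j+1)2^{-k})$, $k\ge 0$, $0\le j<2^k$. For $Q\in\mathcal D(Q_0)$ let $\langle\cdot\rangle_Q$ denote the average over $Q$ of a scalar, vector or matrix function. A $d\times d$ matrix weight is a function $W$ on $Q_0$ with values in $\mathbb C^{d\times d}$ whose entries are integrable and for which $W(x)$ is positive semidefinite for almost every $x\in Q_0$. For a matrix weight $W$ and $f\in L^2(Q_0;\mathbb C^d)$ put $$M^Wf(x)=\sup_{Q\in\mathcal D(Q_0),\,x\in Q}\bigl\|W^{1/2}(x)\,\langle W\rangle_Q^{-1}\,\langle W^{1/2}f\rangle_Q\bigr\|_{\mathbb C^d}\in[0,\infty],$$ where, in case $\langle W\rangle_Q$ is singular, $\langle W\rangle_Q^{-1}$ denotes the inverse on the orthogonal complement of $\ker\langle W\rangle_Q$, extended by $0$ to $\ker\langle W\rangle_Q$. Theorem. For every $d$ there is a constant $C<\infty$, depending only on $d$, such that for every $d\times d$ matrix weight $W$ the operator $M^W$ is bounded from $L^2(Q_0;\mathbb C^d)$ to $L^2(Q_0;\mathbb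 C)$ with bound $C$: for every $f\in L^2(Q_0;\mathbb C^d)$ the function $M^Wf$ is finite almost everywhere, belongs to $L^2(Q_0;\mathbb C)$, and $$\|M^Wf\|_{L^2(Q_0;\mathbb C)}\le C\,\|f\|_{L^2(Q_0;\mathbb C^d)}.$$ -/

import Mathlib

open MeasureTheory
open scoped ENNReal NNReal MatrixOrder ComplexOrder

noncomputable section

namespace MatrixWeighted

/-- The dyadic interval `[j 2⁻ᵏ, (j+1) 2⁻ᵏ)`. The dyadic subintervals of `Q₀ = [0, 1)` are those
with `j < 2 ^ k`. -/
def dyadic (k j : ℕ) : Set ℝ :=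
  Set.Ico ((j : ℝ) / 2 ^ k) (((j : ℝ) + 1) / 2 ^ k)

/-- The collection `𝒟(Q₀)` of dyadic subintervals of `Q₀ = [0, 1)`. -/
def dyadicIntervals : Set (Set ℝ) :=
  {Q | ∃ k j : ℕ, j < 2 ^ k ∧ Q = dyadic k j}

/-- Lebesgue measure on `Q₀`. -/
def mu : Measure ℝ := volume.restrict (Set.Ico (0 : ℝ) 1)

/-- A `d × d` matrix weight on `Q₀`: entrywise integrable and positive semidefinite almost
everywhere. -/
structure IsWeight {d : ℕ} (W : ℝ → Matrix (Fin d) (Fin d) ℂ) : Prop where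
  integrable : ∀ i j, Integrable (fun x => W x i j) mu
  posSemidef : ∀ᵐ x ∂mu, (W x).PosSemidef

/-- The entrywise average `⟨W⟩_Q` of a matrix function. -/
def matrixAvg {d : ℕ} (W : ℝ → Matrix (Fin d) (Fin d) ℂ) (Q : Set ℝ) :
    Matrix (Fin d) (Fin d) ℂ :=
  Matrix.of fun i j => ⨍ x in Q, W x i j

/-- The inverse of a Hermitian matrix on the orthogonal complement of its kernel, extended by `0`
on the kernel (the functional calculus of `t ↦ t⁻¹`, where `0⁻¹ = 0`). -/
def hermInv {d : ℕ} (A : Matrix (Fin d) (Fin d) ℂ) : Matrix (Fin d) (Fin d) ℂ :=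
  cfc (fun t : ℝ => t⁻¹) A

/-- For invertible Hermitian matrices `hermInv` is the usual inverse. -/
theorem hermInv_eq_inv {d : ℕ} {A : Matrix (Fin d) (Fin d) ℂ} (hA : A.IsHermitian)
    (h : IsUnit A) : hermInv A = A⁻¹ := by
  obtain ⟨u, rfl⟩ := h
  rw [hermInv, cfc_inv_id (R := ℝ) u hA.isSelfAdjoint, Matrix.coe_units_inv]

/-- The average `⟨W^{1/2} f⟩_Q`. -/
def weightedAvg {d : ℕ} (W : ℝ → Matrix (Fin d) (Fin d) ℂ) (f : ℝ → EuclideanSpace ℂ (Fin d))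
    (Q : Set ℝ) : EuclideanSpace ℂ (Fin d) :=
  ⨍ x in Q, Matrix.toEuclideanLin (CFC.sqrt (W x)) (f x)

/-- The maximal function
`M^W f (x) = sup_{Q ∈ 𝒟(Q₀), x ∈ Q} ‖W^{1/2}(x) ⟨W⟩_Q⁻¹ ⟨W^{1/2} f⟩_Q‖`, with values in
`[0, ∞]`. -/
def maximal {d : ℕ} (W : ℝ → Matrix (Fin d) (Fin d) ℂ) (f : ℝ → EuclideanSpace ℂ (Fin d))
    (x : ℝ) : ℝ≥0∞ :=
  ⨆ Q ∈ {Q ∈ dyadicIntervals | x ∈ Q},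
    ‖Matrix.toEuclideanLin (CFC.sqrt (W x) * hermInv (matrixAvg W Q)) (weightedAvg W f Q)‖ₑ

end MatrixWeighted

end

/-!
For a measurable choice `k(x)` of the generation of the dyadic interval `Q ∋ x`, the supremum
becomes a sum over intervals `Q` of `⟨α_Q W_Q⁻¹ v_Q, W_Q⁻¹ v_Q⟩`, where `W_Q = ∫_Q W`,
`v_Q = ∫_Q W^{1/2} f`, and `α_Q` is the integral of `W` over the part of `Q` where `Q` is chosen.
The total mass `m_Q` of the `α_R`, `R ⊆ Q`, satisfies the Carleson condition `m_Q ≤ W_Q`, so the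
claim is a matrix Carleson embedding. The Bellman function `⟨A⁻¹ v, v⟩` is subadditive in
`(A, v)`, and with `A = W_Q + s m_Q` it gains `s ⟨α_Q A⁻¹ v_Q, A⁻¹ v_Q⟩` from `Q` to its two
halves; hence the embedding holds with `W_Q⁻¹` replaced by `(W_Q + s m_Q)⁻¹`, `s > 0`. The
adjugate of `W_Q + s m_Q` is a polynomial in `s` of degree at most `d`, so its value at `s = 0` is
a linear combination of the values at `s = 1, …, d + 1`, which transfers the estimate to `s = 0`.
Singular weights are reached as the limit of `W_Q + ε |Q|`.
-/

noncomputable section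

namespace MatrixWeighted

open Filter Matrix Topology

section Extrapolation

variable {R : Type*} [CommRing R]

lemma eval_zero_eq_sum_choose_mul_eval (p : Polynomial R) {N : ℕ} (hp : p.natDegree < N) :
    p.eval 0 = ∑ i ∈ Finset.range N, (-1) ^ i * (N.choose (i + 1) : R) * p.eval (i + 1 : R) := by
  have hΔ := congrFun (Polynomial.fwdDiff_iter_eq_zero_of_degree_lt hp) 0
  rw [fwdDiff_iter_eq_sum_shift, Finset.sum_range_succ', Pi.zero_apply] at hΔ
  simp only [zsmul_eq_mul, nsmul_eq_mul, mul_one, zero_add, Nat.cast_zero, tsub_zero,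
    Nat.choose_zero_right] at hΔ
  push_cast [mul_assoc] at hΔ
  have hsq : (-1 : R) ^ N * (-1) ^ N = 1 := by rw [← mul_pow, neg_one_mul, neg_neg, one_pow]
  have hsign : ∀ i < N, (-1 : R) ^ N * (-1) ^ (N - (i + 1)) = -(-1) ^ i := fun i hi => by
    obtain ⟨m, rfl⟩ := Nat.exists_eq_add_of_lt hi
    rw [show i + m + 1 - (i + 1) = m by lia]
    linear_combination (-(-1) ^ i) * (Even.neg_one_pow ⟨m, rfl⟩ : (-1 : R) ^ (m + m) = 1)
  calc p.eval 0 = ∑ i ∈ Finset.range N, -((-1) ^ N * (-1) ^ (N - (i + 1))) *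
        (N.choose (i + 1) * p.eval (i + 1 : R)) := by
        simp only [neg_mul, Finset.sum_neg_distrib, mul_assoc, ← Finset.mul_sum]
        linear_combination (-1) ^ N * hΔ - p.eval 0 * hsq
    _ = _ := Finset.sum_congr rfl fun i hi => by
        rw [hsign i (Finset.mem_range.mp hi)]
        ring

variable {n : Type*} [Fintype n] [DecidableEq n]

lemma adjugate_eq_sum_choose_smul_adjugate (A B : Matrix n n R) {N : ℕ} (hN : Fintype.card n < N) :
    A.adjugate = ∑ i ∈ Finset.range N,
      ((-1) ^ i * (N.choose (i + 1) : R)) • (A + (i + 1 : R) • B).adjugate := by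
  ext a b
  set p : Polynomial R := det ((Polynomial.X : Polynomial R) • (B.updateRow b 0).map Polynomial.C +
    (A.updateRow b (Pi.single a 1)).map Polynomial.C)
  have hp : p.natDegree < N := (Polynomial.natDegree_det_X_add_C_le _ _).trans_lt hN
  have heval : ∀ x : R, p.eval x = (A + x • B).adjugate a b := fun x => by
    rw [adjugate_apply, Polynomial.eval, ← Polynomial.coe_eval₂RingHom, RingHom.map_det]
    congr 1
    ext i j
    by_cases h : i = b <;> simp [h, updateRow_apply, add_comm (A _ _), mul_comm (B _ _)]
  have h := eval_zero_eq_sum_choose_mul_eval p hp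
  simp only [heval, zero_smul, add_zero] at h
  simp only [h, Matrix.sum_apply, Matrix.smul_apply, smul_eq_mul]

lemma inv_eq_sum_choose_smul_inv {K : Type*} [Field K] {A B : Matrix n n K} {N : ℕ}
    (hN : Fintype.card n < N) (h : ∀ i < N, (A + (i + 1 : K) • B).det ≠ 0) :
    A⁻¹ = ∑ i ∈ Finset.range N, ((-1) ^ i * (N.choose (i + 1) : K) *
      ((A + (i + 1 : K) • B).det / A.det)) • (A + (i + 1 : K) • B)⁻¹ := by
  rw [inv_def, adjugate_eq_sum_choose_smul_adjugate A B hN, Finset.smul_sum]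
  refine Finset.sum_congr rfl fun i hi => ?_
  rw [inv_def, smul_smul, smul_smul, Ring.inverse_eq_inv']
  congr 1
  have := h i (Finset.mem_range.mp hi)
  field_simp

end Extrapolation

section Determinant

variable {n 𝕜 : Type*} [Fintype n] [DecidableEq n] [RCLike 𝕜]

lemma one_le_det_one_add {T : Matrix n n 𝕜} (hT : 0 ≤ T) : 1 ≤ (1 + T).det := by
  have hH : (1 + T).IsHermitian := isHermitian_one.add (nonneg_iff_posSemidef.mp hT).1
  have h : ∀ i, 1 ≤ hH.eigenvalues i := fun i =>
    (CFC.one_le_iff (1 + T) hH.isSelfAdjoint).mp (le_add_of_nonneg_right hT) _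
      (hH.eigenvalues_mem_spectrum_real i)
  rw [hH.det_eq_prod_eigenvalues]
  exact_mod_cast Finset.one_le_prod fun i _ => h i

lemma det_mono {A B : Matrix n n 𝕜} (hA : 0 ≤ A) (hAB : A ≤ B) : A.det ≤ B.det := by
  by_cases hdet : A.det = 0
  · rw [hdet]
    exact (nonneg_iff_posSemidef.mp (hA.trans hAB)).det_nonneg
  set R := CFC.sqrt A
  have hRR : R * R = A := CFC.sqrt_mul_sqrt_self A
  have hR : IsUnit R.det := by
    refine isUnit_iff_ne_zero.mpr fun h => hdet ?_
    rw [← hRR, det_mul, h, mul_zero]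
  have hRinv : (R⁻¹)ᴴ = R⁻¹ := by
    rw [conjTranspose_nonsing_inv, (nonneg_iff_posSemidef.mp (CFC.sqrt_nonneg A)).1.eq]
  have hT : 0 ≤ R⁻¹ * (B - A) * R⁻¹ := by
    have h := (le_iff.mp hAB).mul_mul_conjTranspose_same R⁻¹
    rwa [hRinv, ← nonneg_iff_posSemidef] at h
  have hB : B = R * (1 + R⁻¹ * (B - A) * R⁻¹) * R := by
    rw [mul_add, add_mul, mul_one, hRR, Matrix.mul_assoc R⁻¹, mul_nonsing_inv_cancel_left _ _ hR,
      nonsing_inv_mul_cancel_right _ _ hR, add_sub_cancel]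
  calc A.det = A.det * 1 := (mul_one _).symm
    _ ≤ A.det * (1 + R⁻¹ * (B - A) * R⁻¹).det :=
        mul_le_mul_of_nonneg_left (one_le_det_one_add hT)
          (nonneg_iff_posSemidef.mp hA).det_nonneg
    _ = B.det := by
        conv_rhs => rw [hB]
        rw [det_mul, det_mul, ← hRR, det_mul]
        ring

lemma det_add_smul_le {A B : Matrix n n 𝕜} (hB : 0 ≤ B) (hBA : B ≤ A) {s : ℝ} (hs : 0 ≤ s) :
    (A + s • B).det ≤ (1 + s : 𝕜) ^ Fintype.card n * A.det := by
  have h : A + s • B ≤ (1 + s) • A := by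
    rw [add_smul, one_smul]
    gcongr
  refine (det_mono ?_ h).trans_eq ?_
  · exact add_nonneg (hB.trans hBA) (smul_nonneg hs hB)
  · rw [show (1 + s) • A = (1 + s : 𝕜) • A by simp [add_smul], det_smul]

end Determinant

section Energy

variable {n 𝕜 : Type*} [Fintype n] [RCLike 𝕜] {A B α : Matrix n n 𝕜} {c : ℝ} {u v : n → 𝕜}

/-- The quadratic form of a Hermitian matrix; for an arbitrary matrix, its real part. -/
def quad (A : Matrix n n 𝕜) (x : n → 𝕜) : ℝ :=
  RCLike.re (star x ⬝ᵥ A *ᵥ x)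

lemma quad_add (A B : Matrix n n 𝕜) (x : n → 𝕜) : quad (A + B) x = quad A x + quad B x := by
  simp only [quad, add_mulVec, dotProduct_add, map_add]

lemma quad_smul (s : ℝ) (A : Matrix n n 𝕜) (x : n → 𝕜) : quad (s • A) x = s * quad A x := by
  simp only [quad, smul_mulVec, dotProduct_smul, RCLike.smul_re]

lemma quad_nonneg (hA : 0 ≤ A) (x : n → 𝕜) : 0 ≤ quad A x :=
  (nonneg_iff_posSemidef.mp hA).re_dotProduct_nonneg x

lemma quad_mono (hAB : A ≤ B) (x : n → 𝕜) : quad A x ≤ quad B x := by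
  rw [← add_sub_cancel A B, quad_add]
  exact le_add_of_nonneg_right (quad_nonneg (sub_nonneg.mpr hAB) x)

/-- A variational form of `⟨A⁻¹ v, v⟩ ≤ c` for positive semidefinite `A`, which makes sense also
when `A` is singular. -/
def EnergyLE (A : Matrix n n 𝕜) (v : n → 𝕜) (c : ℝ) : Prop :=
  ∀ e, 2 * RCLike.re (star e ⬝ᵥ v) - quad A e ≤ c

lemma EnergyLE.mono (h : EnergyLE A v c) (hAB : A ≤ B) : EnergyLE B v c :=
  fun e => (sub_le_sub_left (quad_mono hAB e) _).trans (h e)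

open scoped Classical in
lemma quad_eq_norm_sqrt_sq (hA : 0 ≤ A) (x : n → 𝕜) :
    quad A x = ‖WithLp.toLp 2 (CFC.sqrt A *ᵥ x)‖ ^ 2 := by
  have hR : (CFC.sqrt A)ᴴ = CFC.sqrt A := (nonneg_iff_posSemidef.mp (CFC.sqrt_nonneg A)).1
  rw [← inner_self_eq_norm_sq (𝕜 := 𝕜), EuclideanSpace.inner_toLp_toLp, dotProduct_comm,
    star_mulVec, hR, ← dotProduct_mulVec, mulVec_mulVec, CFC.sqrt_mul_sqrt_self A, quad]

lemma quad_sum_smul_le (hA : 0 ≤ A) {ι : Type*} (s : Finset ι) (c : ι → 𝕜) (x : ι → n → 𝕜) :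
    quad A (∑ i ∈ s, c i • x i) ≤ s.card * ∑ i ∈ s, ‖c i‖ ^ 2 * quad A (x i) := by
  simp only [quad_eq_norm_sqrt_sq hA, mulVec_sum, mulVec_smul, WithLp.toLp_sum, WithLp.toLp_smul,
    ← mul_pow, ← norm_smul]
  exact (pow_le_pow_left₀ (norm_nonneg _) (norm_sum_le _ _) 2).trans sq_sum_le_card_mul_sum_sq

variable [DecidableEq n]

lemma quad_sub_inv_mulVec (hA : A.PosDef) (e v : n → 𝕜) :
    quad A (e - A⁻¹ *ᵥ v) = quad A e - 2 * RCLike.re (star e ⬝ᵥ v) + quad A⁻¹ v := by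
  have hdet : IsUnit A.det := isUnit_iff_ne_zero.mpr hA.det_pos.ne'
  have hAv : A *ᵥ A⁻¹ *ᵥ v = v := by rw [mulVec_mulVec, mul_nonsing_inv _ hdet, one_mulVec]
  have hcross : star (A⁻¹ *ᵥ v) ⬝ᵥ A *ᵥ e = star (star e ⬝ᵥ v) := by
    rw [star_mulVec, hA.1.inv.eq, ← dotProduct_mulVec, mulVec_mulVec, nonsing_inv_mul _ hdet,
      one_mulVec, star_dotProduct]
  have hself : star (A⁻¹ *ᵥ v) ⬝ᵥ v = star v ⬝ᵥ A⁻¹ *ᵥ v := by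
    rw [star_mulVec, hA.1.inv.eq, ← dotProduct_mulVec]
  simp only [quad, mulVec_sub, star_sub, dotProduct_sub, sub_dotProduct, hAv, hcross, hself,
    map_sub, RCLike.star_def, RCLike.conj_re]
  ring

lemma energy_inv_mulVec (hA : A.PosDef) (v : n → 𝕜) :
    2 * RCLike.re (star (A⁻¹ *ᵥ v) ⬝ᵥ v) - quad A (A⁻¹ *ᵥ v) = quad A⁻¹ v := by
  have h := quad_sub_inv_mulVec hA (A⁻¹ *ᵥ v) v
  rw [sub_self, quad, star_zero, zero_dotProduct, map_zero] at h
  linarith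

lemma energyLE_quad_inv (hA : A.PosDef) (v : n → 𝕜) : EnergyLE A v (quad A⁻¹ v) := fun e => by
  have h := quad_sub_inv_mulVec hA e v
  linarith [quad_nonneg hA.posSemidef.nonneg (e - A⁻¹ *ᵥ v)]

lemma EnergyLE.quad_inv_le (h : EnergyLE A v c) (hA : A.PosDef) : quad A⁻¹ v ≤ c :=
  energy_inv_mulVec hA v ▸ h _

lemma quad_inv_add_le {P : Matrix n n 𝕜} (hA : A.PosDef) (hB : B.PosDef) (hP : P.PosDef)
    (hPAB : P = A + B + α) (u v : n → 𝕜) :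
    quad P⁻¹ (u + v) + quad α (P⁻¹ *ᵥ (u + v)) ≤ quad A⁻¹ u + quad B⁻¹ v := by
  set e := P⁻¹ *ᵥ (u + v) with he
  calc quad P⁻¹ (u + v) + quad α e
      = (2 * RCLike.re (star e ⬝ᵥ u) - quad A e) + (2 * RCLike.re (star e ⬝ᵥ v) - quad B e) := by
        rw [← energy_inv_mulVec hP, ← he, hPAB, quad_add, quad_add, dotProduct_add, map_add]
        ring
    _ ≤ quad A⁻¹ u + quad B⁻¹ v := add_le_add (energyLE_quad_inv hA u e) (energyLE_quad_inv hB v e)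

lemma norm_det_add_smul_div_le {m w : Matrix n n 𝕜} (hm : 0 ≤ m) (hmw : m ≤ w) (hw : w.PosDef)
    {s : ℝ} (hs : 0 ≤ s) :
    ‖(w + s • m).det / w.det‖ ≤ (1 + s) ^ Fintype.card n := by
  have hle := det_add_smul_le hm hmw hs
  have h0 : 0 ≤ (w + s • m).det :=
    (hw.posSemidef.add ((nonneg_iff_posSemidef.mp hm).smul hs)).det_nonneg
  rw [norm_div, div_le_iff₀ (norm_pos_iff.mpr hw.det_pos.ne')]
  rw [← RCLike.norm_of_nonneg' h0, ← RCLike.norm_of_nonneg' hw.det_pos.le] at hle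
  exact_mod_cast hle

end Energy

section Tree

/-- Additivity of a set function on dyadic intervals: `a k j` is its value on the `j`-th interval of
generation `k`, whose children are the intervals `2 * j` and `2 * j + 1` of generation `k + 1`. -/
def IsDyadicAdditive {M : Type*} [Add M] (a : ℕ → ℕ → M) : Prop :=
  ∀ k j, a k j = a (k + 1) (2 * j) + a (k + 1) (2 * j + 1)

lemma sum_range_two_pow_succ {M : Type*} [AddCommMonoid M] (k : ℕ) (g : ℕ → M) :
    ∑ j ∈ Finset.range (2 ^ (k + 1)), g j =
      ∑ j ∈ Finset.range (2 ^ k), (g (2 * j) + g (2 * j + 1)) := by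
  rw [pow_succ, mul_comm]
  induction 2 ^ k with
  | zero => rfl
  | succ m ih => rw [mul_add, Finset.sum_range_succ, ← ih, mul_one, Finset.sum_range_succ,
      Finset.sum_range_succ, add_assoc]

lemma IsDyadicAdditive.sum_eq {M : Type*} [AddCommMonoid M] {a : ℕ → ℕ → M}
    (ha : IsDyadicAdditive a) (k : ℕ) : ∑ j ∈ Finset.range (2 ^ k), a k j = a 0 0 := by
  induction k with
  | zero => simp
  | succ k ih =>
    rw [sum_range_two_pow_succ, ← ih]
    exact Finset.sum_congr rfl fun j _ => (ha k j).symm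

lemma dyadic_telescope {φ ψ : ℕ → ℕ → ℝ}
    (h : ∀ k j, φ k j + ψ k j ≤ φ (k + 1) (2 * j) + φ (k + 1) (2 * j + 1)) (N : ℕ) :
    φ 0 0 + ∑ k ∈ Finset.range N, ∑ j ∈ Finset.range (2 ^ k), ψ k j ≤
      ∑ j ∈ Finset.range (2 ^ N), φ N j := by
  induction N with
  | zero => simp
  | succ N ih =>
    rw [Finset.sum_range_succ, ← add_assoc, sum_range_two_pow_succ]
    grw [ih]
    rw [← Finset.sum_add_distrib]
    exact Finset.sum_le_sum fun j _ => h N j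

end Tree

section Embedding

variable {n 𝕜 : Type*} [Fintype n] [RCLike 𝕜]
  {w m α : ℕ → ℕ → Matrix n n 𝕜} {v : ℕ → ℕ → n → 𝕜} {F : ℕ → ℕ → ℝ}

/-- The hypotheses of the matrix Carleson embedding: `α k j` is the Carleson mass placed at the
node `(k, j)` of the binary tree, `m k j` the total mass at or below that node, and the Carleson
condition is `m k j ≤ w k j`. -/
structure CarlesonData (w m α : ℕ → ℕ → Matrix n n 𝕜) (v : ℕ → ℕ → n → 𝕜) (F : ℕ → ℕ → ℝ) :
    Prop where
  weight_add : IsDyadicAdditive w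
  vec_add : IsDyadicAdditive v
  energy_add : IsDyadicAdditive F
  mass_eq : ∀ k j, m k j = m (k + 1) (2 * j) + m (k + 1) (2 * j + 1) + α k j
  node_nonneg : ∀ k j, 0 ≤ α k j
  mass_nonneg : ∀ k j, 0 ≤ m k j
  mass_le : ∀ k j, m k j ≤ w k j
  energyLE : ∀ k j, EnergyLE (w k j) (v k j) (F k j)

variable [DecidableEq n]

lemma CarlesonData.sum_quad_perturbed_le (h : CarlesonData w m α v F) (hw : ∀ k j, (w k j).PosDef)
    {s : ℝ} (hs : 0 < s) (N : ℕ) :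
    s * ∑ k ∈ Finset.range N, ∑ j ∈ Finset.range (2 ^ k),
      quad (α k j) ((w k j + s • m k j)⁻¹ *ᵥ v k j) ≤ F 0 0 := by
  have hle : ∀ k j, w k j ≤ w k j + s • m k j := fun k j =>
    le_add_of_nonneg_right (smul_nonneg hs.le (h.mass_nonneg k j))
  have hpd : ∀ k j, (w k j + s • m k j).PosDef := fun k j =>
    (hw k j).add_posSemidef (nonneg_iff_posSemidef.mp (smul_nonneg hs.le (h.mass_nonneg k j)))
  have hstep : ∀ k j, quad (w k j + s • m k j)⁻¹ (v k j) +
      s * quad (α k j) ((w k j + s • m k j)⁻¹ *ᵥ v k j) ≤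
      quad (w (k + 1) (2 * j) + s • m (k + 1) (2 * j))⁻¹ (v (k + 1) (2 * j)) +
      quad (w (k + 1) (2 * j + 1) + s • m (k + 1) (2 * j + 1))⁻¹ (v (k + 1) (2 * j + 1)) := by
    intro k j
    rw [← quad_smul, h.vec_add k j]
    refine quad_inv_add_le (hpd _ _) (hpd _ _) (hpd k j) ?_ _ _
    rw [h.weight_add k j, h.mass_eq k j]
    module
  calc s * ∑ k ∈ Finset.range N, ∑ j ∈ Finset.range (2 ^ k),
        quad (α k j) ((w k j + s • m k j)⁻¹ *ᵥ v k j)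
      ≤ quad (w 0 0 + s • m 0 0)⁻¹ (v 0 0) + ∑ k ∈ Finset.range N, ∑ j ∈ Finset.range (2 ^ k),
          s * quad (α k j) ((w k j + s • m k j)⁻¹ *ᵥ v k j) := by
        simp only [Finset.mul_sum]
        exact le_add_of_nonneg_left (quad_nonneg (hpd 0 0).inv.posSemidef.nonneg _)
    _ ≤ ∑ j ∈ Finset.range (2 ^ N), quad (w N j + s • m N j)⁻¹ (v N j) := dyadic_telescope hstep N
    _ ≤ ∑ j ∈ Finset.range (2 ^ N), F N j := Finset.sum_le_sum fun j _ =>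
        ((h.energyLE N j).mono (hle N j)).quad_inv_le (hpd N j)
    _ = F 0 0 := h.energy_add.sum_eq N

/-- The weight of the node `i + 1` in the extrapolation of `(w + s m)⁻¹` from `s = 1, …, n + 1` to
`s = 0`: a binomial coefficient times a bound for `det (w + (i + 1) m) / det w`. -/
def extrapolationWeight (n i : ℕ) : ℝ :=
  (n + 1).choose (i + 1) * (1 + (i + 1)) ^ n

/-- The constant in the matrix Carleson embedding theorem in dimension `n`. -/
def carlesonConst (n : ℕ) : ℝ :=
  (n + 1) * ∑ i ∈ Finset.range (n + 1), extrapolationWeight n i ^ 2 / (i + 1)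

lemma carlesonConst_nonneg (n : ℕ) : 0 ≤ carlesonConst n := by
  unfold carlesonConst
  positivity

lemma quad_inv_mulVec_le_sum {w m α : Matrix n n 𝕜} (hw : w.PosDef) (hm : 0 ≤ m) (hmw : m ≤ w)
    (hα : 0 ≤ α) (v : n → 𝕜) :
    quad α (w⁻¹ *ᵥ v) ≤ (Fintype.card n + 1) * ∑ i ∈ Finset.range (Fintype.card n + 1),
      extrapolationWeight (Fintype.card n) i ^ 2 * quad α ((w + (i + 1 : ℝ) • m)⁻¹ *ᵥ v) := by
  set N := Fintype.card n + 1
  have hs : ∀ i : ℕ, (0 : ℝ) ≤ i + 1 := fun i => by positivity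
  have hcast : ∀ i : ℕ, (i + 1 : 𝕜) • m = (i + 1 : ℝ) • m := fun i => by
    rw [RCLike.real_smul_eq_coe_smul (K := 𝕜)]
    simp
  have hdet : ∀ i < N, (w + (i + 1 : 𝕜) • m).det ≠ 0 := fun i _ => by
    rw [hcast]
    exact (hw.add_posSemidef
      (nonneg_iff_posSemidef.mp (smul_nonneg (hs i) hm))).det_pos.ne'
  have hinv := inv_eq_sum_choose_smul_inv (Nat.lt_succ_self _) hdet
  simp only [hcast] at hinv
  rw [hinv, sum_mulVec]
  simp only [smul_mulVec]
  refine (quad_sum_smul_le hα _ _ _).trans ?_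
  rw [Finset.card_range]
  push_cast [N]
  gcongr with i
  · exact quad_nonneg hα _
  · rw [norm_mul, norm_mul, norm_pow, norm_neg, norm_one, one_pow, one_mul, RCLike.norm_natCast]
    exact mul_le_mul_of_nonneg_left (norm_det_add_smul_div_le hm hmw hw (hs i)) (Nat.cast_nonneg _)

lemma CarlesonData.sum_quad_inv_le (h : CarlesonData w m α v F) (hw : ∀ k j, (w k j).PosDef)
    (N : ℕ) :
    ∑ k ∈ Finset.range N, ∑ j ∈ Finset.range (2 ^ k), quad (α k j) ((w k j)⁻¹ *ᵥ v k j) ≤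
      carlesonConst (Fintype.card n) * F 0 0 := by
  set d := Fintype.card n
  calc ∑ k ∈ Finset.range N, ∑ j ∈ Finset.range (2 ^ k), quad (α k j) ((w k j)⁻¹ *ᵥ v k j)
      ≤ ∑ k ∈ Finset.range N, ∑ j ∈ Finset.range (2 ^ k), (d + 1) * ∑ i ∈ Finset.range (d + 1),
          extrapolationWeight d i ^ 2 *
            quad (α k j) ((w k j + (i + 1 : ℝ) • m k j)⁻¹ *ᵥ v k j) :=
        Finset.sum_le_sum fun k _ => Finset.sum_le_sum fun j _ => quad_inv_mulVec_le_sum (hw k j)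
          (h.mass_nonneg k j) (h.mass_le k j) (h.node_nonneg k j) _
    _ = (d + 1) * ∑ i ∈ Finset.range (d + 1), extrapolationWeight d i ^ 2 *
          ∑ k ∈ Finset.range N, ∑ j ∈ Finset.range (2 ^ k),
            quad (α k j) ((w k j + (i + 1 : ℝ) • m k j)⁻¹ *ᵥ v k j) := by
        simp only [Finset.mul_sum]
        rw [Finset.sum_comm, Finset.sum_congr rfl fun k _ => Finset.sum_comm]
    _ ≤ (d + 1) * ∑ i ∈ Finset.range (d + 1), extrapolationWeight d i ^ 2 * (F 0 0 / (i + 1)) := by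
        gcongr with i
        rw [le_div_iff₀' (by positivity)]
        exact h.sum_quad_perturbed_le hw (by positivity) N
    _ = carlesonConst d * F 0 0 := by
        rw [carlesonConst, mul_assoc, Finset.sum_mul]
        simp only [mul_div_assoc', div_mul_eq_mul_div]

lemma CarlesonData.add_smul_one (h : CarlesonData w m α v F) {ε : ℝ} (hε : 0 ≤ ε) :
    CarlesonData (fun k j => w k j + (ε / 2 ^ k) • 1) m α v F where
  weight_add k j := by
    simp only [h.weight_add k j, pow_succ]
    module
  vec_add := h.vec_add
  energy_add := h.energy_add
  mass_eq := h.mass_eq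
  node_nonneg := h.node_nonneg
  mass_nonneg := h.mass_nonneg
  mass_le k j := (h.mass_le k j).trans
    (le_add_of_nonneg_right (smul_nonneg (by positivity) zero_le_one))
  energyLE k j := (h.energyLE k j).mono
    (le_add_of_nonneg_right (smul_nonneg (by positivity) zero_le_one))

end Embedding

section PseudoInverse

variable {d : ℕ} {A : Matrix (Fin d) (Fin d) ℂ} {v : Fin d → ℂ} {c : ℝ}

lemma continuousOn_spectrum_real {n : Type*} [Fintype n] [DecidableEq n] (f : ℝ → ℝ)
    (A : Matrix n n ℂ) :
    ContinuousOn f (spectrum ℝ A) :=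
  finite_real_spectrum.continuousOn f

lemma hermInv_mul_self (hA : IsSelfAdjoint A) :
    hermInv A * A = cfc (fun t : ℝ => t⁻¹ * t) A := by
  rw [cfc_mul _ _ A (continuousOn_spectrum_real _ A), cfc_id' ℝ A hA, hermInv]

lemma self_mul_hermInv (hA : IsSelfAdjoint A) : A * hermInv A = hermInv A * A := by
  rw [hermInv_mul_self hA, hermInv]
  nth_rw 1 [← cfc_id' ℝ A hA]
  rw [← cfc_mul _ _ A (continuousOn_spectrum_real _ A) (continuousOn_spectrum_real _ A)]
  simp only [mul_comm]

lemma self_mul_hermInv_mul_self (hA : IsSelfAdjoint A) : A * hermInv A * A = A := by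
  rw [mul_assoc, hermInv_mul_self hA]
  nth_rw 1 [← cfc_id' ℝ A hA]
  rw [← cfc_mul _ _ A (continuousOn_spectrum_real _ A) (continuousOn_spectrum_real _ A)]
  simp only [← mul_assoc, mul_inv_mul_cancel, cfc_id' ℝ A hA]

lemma hermInv_smul (hA : IsSelfAdjoint A) (s : ℝ) : hermInv (s • A) = s⁻¹ • hermInv A := by
  rw [hermInv, hermInv, ← cfc_comp_smul s _ A ((finite_real_spectrum.image _).continuousOn _) hA,
    ← cfc_smul s⁻¹ _ A (continuousOn_spectrum_real _ A)]
  simp only [smul_eq_mul, mul_inv]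

lemma EnergyLE.mulVec_hermInv_mulVec (h : EnergyLE A v c) (hA : IsSelfAdjoint A) :
    A *ᵥ hermInv A *ᵥ v = v := by
  have horth : ∀ e, A *ᵥ e = 0 → RCLike.re (star e ⬝ᵥ v) ≤ 0 := fun e he => by
    have hlin : ∀ t : ℝ, 2 * (t * RCLike.re (star e ⬝ᵥ v)) ≤ c := fun t => by
      have := h (t • e)
      simpa [quad, mulVec_smul, he, smul_dotProduct] using this
    by_contra! hpos
    have := hlin ((c + 1) / RCLike.re (star e ⬝ᵥ v))
    have h0 := hlin 0
    rw [div_mul_cancel₀ _ hpos.ne'] at this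
    linarith
  set P := 1 - A * hermInv A with hPdef
  have hP : Pᴴ = P := by
    have hInv : IsSelfAdjoint (hermInv A) := cfc_predicate _ A
    rw [hPdef, conjTranspose_sub, conjTranspose_one, conjTranspose_mul, hInv.isHermitian.eq,
      hA.isHermitian.eq, self_mul_hermInv hA]
  have hAP : A * P = 0 := by
    rw [hPdef, mul_sub, mul_one, self_mul_hermInv hA, ← mul_assoc, self_mul_hermInv_mul_self hA,
      sub_self]
  have hPv : P *ᵥ v = 0 := by
    have := horth (P *ᵥ P *ᵥ v) (by rw [mulVec_mulVec, hAP, zero_mulVec])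
    rw [star_mulVec, hP, ← dotProduct_mulVec] at this
    have hnonneg := Complex.nonneg_iff.mp (dotProduct_star_self_nonneg (P *ᵥ v))
    exact dotProduct_star_self_eq_zero.mp
      (Complex.ext (le_antisymm this hnonneg.1) hnonneg.2.symm)
  rw [sub_mulVec, one_mulVec, sub_eq_zero, ← mulVec_mulVec] at hPv
  exact hPv.symm

lemma inv_add_smul_one_eq_cfc (hA : 0 ≤ A) {ε : ℝ} (hε : 0 < ε) :
    (A + ε • 1)⁻¹ = cfc (fun t : ℝ => (t + ε)⁻¹) A := by
  have hpd : (A + ε • 1).PosDef := .posSemidef_add (nonneg_iff_posSemidef.mp hA) (.smul .one hε)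
  have hA' := IsSelfAdjoint.of_nonneg hA
  rw [← hermInv_eq_inv hpd.1 hpd.isUnit, hermInv, cfc_comp' (fun t : ℝ => t⁻¹) (fun t : ℝ => t + ε)
    A ((finite_real_spectrum.image _).continuousOn _),
    cfc_add_const ε (fun t : ℝ => t) A, cfc_id' ℝ A, Algebra.algebraMap_eq_smul_one]

lemma tendsto_inv_add_smul_one_mul (hA : 0 ≤ A) :
    Tendsto (fun ε : ℝ => (A + ε • 1)⁻¹ * A) (𝓝[>] 0) (𝓝 (hermInv A * A)) := by
  have hA' := IsSelfAdjoint.of_nonneg hA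
  have heq : ∀ᶠ ε : ℝ in 𝓝[>] 0, cfc (fun t : ℝ => (t + ε)⁻¹ * t) A = (A + ε • 1)⁻¹ * A := by
    filter_upwards [self_mem_nhdsWithin] with ε hε
    rw [cfc_mul _ _ A (continuousOn_spectrum_real _ A), cfc_id' ℝ A,
      inv_add_smul_one_eq_cfc hA hε]
  rw [hermInv_mul_self hA']
  refine (tendsto_cfc_fun ?_ (.of_forall fun ε => continuousOn_spectrum_real _ A)).congr' heq
  intro u hu
  refine (eventually_all_finite finite_real_spectrum).mpr fun t _ => ?_
  have ht : Tendsto (fun ε : ℝ => (t + ε)⁻¹ * t) (𝓝[>] 0) (𝓝 (t⁻¹ * t)) := by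
    rcases eq_or_ne t 0 with rfl | ht
    · simp
    · have hcont : ContinuousAt (fun ε : ℝ => (t + ε)⁻¹ * t) 0 := by
        have : t + 0 ≠ 0 := by rwa [add_zero]
        fun_prop (disch := assumption)
      simpa using hcont.tendsto.mono_left nhdsWithin_le_nhds
  exact Uniform.tendsto_nhds_right.mp ht hu

lemma EnergyLE.tendsto_inv_add_smul_one_mulVec (h : EnergyLE A v c) (hA : 0 ≤ A) :
    Tendsto (fun ε : ℝ => (A + ε • 1)⁻¹ *ᵥ v) (𝓝[>] 0) (𝓝 (hermInv A *ᵥ v)) := by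
  have hv := h.mulVec_hermInv_mulVec (nonneg_iff_posSemidef.mp hA).1
  have hcont : Continuous fun B : Matrix (Fin d) (Fin d) ℂ => B *ᵥ hermInv A *ᵥ v := by fun_prop
  simpa only [Function.comp_def, ← mulVec_mulVec, hv] using
    (hcont.tendsto _).comp (tendsto_inv_add_smul_one_mul hA)

end PseudoInverse

section RegularizedEmbedding

variable {d : ℕ} {w m α : ℕ → ℕ → Matrix (Fin d) (Fin d) ℂ} {v : ℕ → ℕ → Fin d → ℂ}
  {F : ℕ → ℕ → ℝ}

theorem CarlesonData.sum_quad_hermInv_le (h : CarlesonData w m α v F) (N : ℕ) :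
    ∑ k ∈ Finset.range N, ∑ j ∈ Finset.range (2 ^ k), quad (α k j) (hermInv (w k j) *ᵥ v k j) ≤
      carlesonConst d * F 0 0 := by
  have hw : ∀ k j, 0 ≤ w k j := fun k j => (h.mass_nonneg k j).trans (h.mass_le k j)
  have hlim : Tendsto (fun ε : ℝ => ∑ k ∈ Finset.range N, ∑ j ∈ Finset.range (2 ^ k),
      quad (α k j) ((w k j + (ε / 2 ^ k) • 1)⁻¹ *ᵥ v k j)) (𝓝[>] 0)
      (𝓝 (∑ k ∈ Finset.range N, ∑ j ∈ Finset.range (2 ^ k),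
        quad (α k j) (hermInv (w k j) *ᵥ v k j))) := by
    refine tendsto_finsetSum _ fun k _ => tendsto_finsetSum _ fun j _ => ?_
    have hε : Tendsto (fun ε : ℝ => ε / 2 ^ k) (𝓝[>] 0) (𝓝[>] 0) := by
      refine tendsto_nhdsWithin_iff.mpr ⟨?_, ?_⟩
      · simpa using (tendsto_id.div_const (2 ^ k)).mono_left (nhdsWithin_le_nhds (a := (0 : ℝ)))
      · filter_upwards [self_mem_nhdsWithin] with ε hε
        exact div_pos (Set.mem_Ioi.mp hε) (by positivity)
    have hquad : Continuous (quad (α k j)) := by unfold quad; fun_prop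
    exact (hquad.tendsto _).comp
      (((h.energyLE k j).tendsto_inv_add_smul_one_mulVec (hw k j)).comp hε)
  refine le_of_tendsto hlim ?_
  filter_upwards [self_mem_nhdsWithin] with ε hε
  have hpd : ∀ k j, (w k j + (ε / 2 ^ k) • 1).PosDef := fun k j =>
    .posSemidef_add (nonneg_iff_posSemidef.mp (hw k j)) (.smul .one (div_pos hε (by positivity)))
  simpa using (h.add_smul_one (le_of_lt hε)).sum_quad_inv_le hpd N

end RegularizedEmbedding

section Weight

variable {Ω n 𝕜 : Type*} [MeasurableSpace Ω] [RCLike 𝕜] {ν ρ : Measure Ω}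
  {W : Ω → Matrix n n 𝕜}

/-- A matrix weight with respect to an arbitrary measure; `IsWeight` is the case of `mu`. -/
structure IsMatrixWeight (ν : Measure Ω) (W : Ω → Matrix n n 𝕜) : Prop where
  integrable : ∀ i j, Integrable (fun ω => W ω i j) ν
  nonneg : ∀ᵐ ω ∂ν, 0 ≤ W ω

/-- The entrywise integral `∫ W dν` of a matrix function. -/
def matrixIntegral (ν : Measure Ω) (W : Ω → Matrix n n 𝕜) : Matrix n n 𝕜 :=
  of fun i j => ∫ ω, W ω i j ∂ν

lemma IsMatrixWeight.restrict (hW : IsMatrixWeight ν W) (S : Set Ω) :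
    IsMatrixWeight (ν.restrict S) W :=
  ⟨fun i j => (hW.integrable i j).restrict, ae_restrict_of_ae hW.nonneg⟩

lemma IsMatrixWeight.matrixIntegral_add_measure (hν : IsMatrixWeight ν W)
    (hρ : IsMatrixWeight ρ W) :
    matrixIntegral (ν + ρ) W = matrixIntegral ν W + matrixIntegral ρ W := by
  ext i j
  exact integral_add_measure (hν.integrable i j) (hρ.integrable i j)

lemma IsMatrixWeight.aemeasurable_entries [Finite n] (hW : IsMatrixWeight ν W) :
    AEMeasurable (fun ω i j => W ω i j) ν :=
  aemeasurable_pi_lambda _ fun i => aemeasurable_pi_lambda _ fun j =>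
    (hW.integrable i j).aemeasurable

lemma IsMatrixWeight.integrable_dotProduct_mulVec [Fintype n] (hW : IsMatrixWeight ν W)
    (x y : n → 𝕜) : Integrable (fun ω => x ⬝ᵥ W ω *ᵥ y) ν :=
  integrable_finsetSum _ fun i _ =>
    (integrable_finsetSum _ fun j _ => (hW.integrable i j).mul_const _).const_mul _

lemma IsMatrixWeight.dotProduct_matrixIntegral_mulVec [Fintype n] (hW : IsMatrixWeight ν W)
    (x y : n → 𝕜) : x ⬝ᵥ matrixIntegral ν W *ᵥ y = ∫ ω, x ⬝ᵥ W ω *ᵥ y ∂ν := by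
  simp only [dotProduct, mulVec, matrixIntegral, of_apply]
  rw [integral_finsetSum _ fun i _ =>
    (integrable_finsetSum _ fun j _ => (hW.integrable i j).mul_const _).const_mul _]
  refine Finset.sum_congr rfl fun i _ => ?_
  rw [integral_const_mul, integral_finsetSum _ fun j _ => (hW.integrable i j).mul_const _]
  simp only [integral_mul_const]

lemma IsMatrixWeight.integrable_quad [Fintype n] (hW : IsMatrixWeight ν W) (x : n → 𝕜) :
    Integrable (fun ω => quad (W ω) x) ν :=
  (hW.integrable_dotProduct_mulVec (star x) x).re

lemma IsMatrixWeight.quad_matrixIntegral [Fintype n] (hW : IsMatrixWeight ν W) (x : n → 𝕜) :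
    quad (matrixIntegral ν W) x = ∫ ω, quad (W ω) x ∂ν := by
  rw [quad, hW.dotProduct_matrixIntegral_mulVec]
  exact (integral_re (hW.integrable_dotProduct_mulVec (star x) x)).symm

lemma IsMatrixWeight.matrixIntegral_nonneg [Finite n] (hW : IsMatrixWeight ν W) :
    0 ≤ matrixIntegral ν W := by
  have := Fintype.ofFinite n
  refine (PosSemidef.of_dotProduct_mulVec_nonneg ?_ fun x => ?_).nonneg
  · ext i j
    simp only [matrixIntegral, conjTranspose_apply, of_apply, RCLike.star_def, ← integral_conj]
    refine integral_congr_ae ?_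
    filter_upwards [hW.nonneg] with ω hω
    exact (nonneg_iff_posSemidef.mp hω).1.apply i j
  · rw [hW.dotProduct_matrixIntegral_mulVec]
    refine integral_nonneg_of_ae ?_
    filter_upwards [hW.nonneg] with ω hω
    exact (nonneg_iff_posSemidef.mp hω).dotProduct_mulVec_nonneg x

lemma IsMatrixWeight.matrixIntegral_restrict_le [Finite n] (hW : IsMatrixWeight ν W)
    {S : Set Ω} (hS : MeasurableSet S) : matrixIntegral (ν.restrict S) W ≤ matrixIntegral ν W := by
  conv_rhs => rw [← Measure.restrict_add_restrict_compl (μ := ν) hS]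
  rw [(hW.restrict S).matrixIntegral_add_measure (hW.restrict Sᶜ)]
  exact le_add_of_nonneg_right (hW.restrict Sᶜ).matrixIntegral_nonneg

variable [Fintype n]

lemma IsMatrixWeight.aemeasurable_quad (hW : IsMatrixWeight ν W) {x : Ω → n → 𝕜}
    (hx : Measurable x) : AEMeasurable (fun ω => quad (W ω) (x ω)) ν := by
  have hcoord (i : n) : Measurable fun ω => x ω i := (measurable_pi_apply i).comp hx
  exact RCLike.measurable_re.comp_aemeasurable <|
    Finset.aemeasurable_fun_sum _ fun i _ =>
      (continuous_star.measurable.comp (hcoord i)).aemeasurable.mul <|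
        Finset.aemeasurable_fun_sum _ fun j _ =>
          (hW.integrable i j).aemeasurable.mul (hcoord j).aemeasurable

lemma quad_le_card_mul_trace_mul_norm_sq {A : Matrix n n 𝕜} (hA : 0 ≤ A)
    (x : EuclideanSpace 𝕜 n) :
    quad A x.ofLp ≤ Fintype.card n * RCLike.re A.trace * ‖x‖ ^ 2 := by
  classical
  have hdiag : ∀ i, quad A (Pi.single i 1) = RCLike.re (A i i) := fun i => by simp [quad]
  have hx : ∑ i, x i • (Pi.single i 1 : n → 𝕜) = x.ofLp := by
    ext j
    simp [Pi.single_apply]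
  calc quad A x.ofLp ≤ Fintype.card n * ∑ i, ‖x i‖ ^ 2 * quad A (Pi.single i 1) := by
        simpa only [hx, Finset.card_univ] using
          quad_sum_smul_le hA Finset.univ (fun i => x i) fun i => Pi.single i 1
    _ ≤ Fintype.card n * ∑ i, ‖x‖ ^ 2 * quad A (Pi.single i 1) := by
        gcongr with i
        · exact quad_nonneg hA _
        · exact PiLp.norm_apply_le x i
    _ = Fintype.card n * RCLike.re A.trace * ‖x‖ ^ 2 := by
        simp only [hdiag, ← Finset.mul_sum, trace, diag_apply, map_sum]
        ring

variable [DecidableEq n]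

lemma norm_toEuclideanLin_sqrt_sq {A : Matrix n n 𝕜} (hA : 0 ≤ A) (x : EuclideanSpace 𝕜 n) :
    ‖toEuclideanLin (CFC.sqrt A) x‖ ^ 2 = quad A x.ofLp :=
  (quad_eq_norm_sqrt_sq hA x.ofLp).symm

lemma two_mul_re_inner_sqrt_sub_quad_le {A : Matrix n n 𝕜} (hA : 0 ≤ A)
    (e y : EuclideanSpace 𝕜 n) :
    2 * RCLike.re (inner 𝕜 e (toEuclideanLin (CFC.sqrt A) y)) - quad A e.ofLp ≤ ‖y‖ ^ 2 := by
  have hsymm : (toEuclideanLin (CFC.sqrt A)).IsSymmetric :=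
    isSymmetric_toEuclideanLin_iff.mpr (CFC.sqrt_nonneg A).posSemidef.1
  rw [← norm_toEuclideanLin_sqrt_sq hA, ← hsymm]
  have hsq := sq_nonneg ‖toEuclideanLin (CFC.sqrt A) e - y‖
  rw [norm_sub_sq (𝕜 := 𝕜)] at hsq
  linarith

end Weight

section ComplexWeight

variable {Ω n : Type*} [MeasurableSpace Ω] [Fintype n] {ν : Measure Ω} {W : Ω → Matrix n n ℂ}
  {f : Ω → EuclideanSpace ℂ n}

open scoped Classical in
open scoped Matrix.Norms.L2Operator in
lemma continuous_sqrt_abs :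
    Continuous fun A : Matrix n n ℂ => CFC.sqrt (CFC.abs A) :=
  CFC.continuousOn_sqrt.comp_continuous CFC.continuous_abs CFC.abs_nonneg

open scoped Classical in
lemma IsMatrixWeight.aemeasurable_sqrt_apply (hW : IsMatrixWeight ν W) (i j : n) :
    AEMeasurable (fun ω => CFC.sqrt (W ω) i j) ν := by
  have hcont : Continuous fun A : n → n → ℂ => CFC.sqrt (CFC.abs (of A)) i j :=
    continuous_sqrt_abs.matrix_elem i j
  refine (hcont.measurable.comp_aemeasurable hW.aemeasurable_entries).congr ?_
  filter_upwards [hW.nonneg] with ω hω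
  change CFC.sqrt (CFC.abs (W ω)) i j = _
  rw [CFC.abs_of_nonneg (W ω)]

variable [DecidableEq n]

lemma IsMatrixWeight.aestronglyMeasurable_toEuclideanLin_sqrt (hW : IsMatrixWeight ν W)
    (hf : AEStronglyMeasurable f ν) :
    AEStronglyMeasurable (fun ω => toEuclideanLin (CFC.sqrt (W ω)) (f ω)) ν := by
  have hcoord : AEMeasurable (fun ω (i : n) => ∑ j, CFC.sqrt (W ω) i j * f ω j) ν :=
    aemeasurable_pi_lambda _ fun i => Finset.aemeasurable_fun_sum _ fun j _ =>
      (hW.aemeasurable_sqrt_apply i j).mul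
        ((EuclideanSpace.proj (𝕜 := ℂ) j).continuous.comp_aestronglyMeasurable hf).aemeasurable
  exact (PiLp.continuous_toLp 2 (fun _ : n => ℂ)).comp_aestronglyMeasurable
    hcoord.aestronglyMeasurable

lemma IsMatrixWeight.integrable_toEuclideanLin_sqrt (hW : IsMatrixWeight ν W)
    (hf : MemLp f 2 ν) : Integrable (fun ω => toEuclideanLin (CFC.sqrt (W ω)) (f ω)) ν := by
  have htr : Integrable (fun ω => Fintype.card n * RCLike.re (W ω).trace) ν :=
    (integrable_finsetSum _ fun i _ => hW.integrable i i).re.const_mul _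
  refine (htr.add (hf.integrable_norm_pow two_ne_zero)).mono'
    (hW.aestronglyMeasurable_toEuclideanLin_sqrt hf.1) ?_
  filter_upwards [hW.nonneg] with ω hω
  have htr0 : 0 ≤ Fintype.card n * RCLike.re (W ω).trace := mul_nonneg (Nat.cast_nonneg _)
    (RCLike.nonneg_iff.mp (nonneg_iff_posSemidef.mp hω).trace_nonneg).1
  refine le_of_sq_le_sq ?_ (add_nonneg htr0 (sq_nonneg _))
  rw [norm_toEuclideanLin_sqrt_sq hω]
  refine (quad_le_card_mul_trace_mul_norm_sq hω (f ω)).trans ?_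
  change _ ≤ (Fintype.card n * RCLike.re (W ω).trace + ‖f ω‖ ^ 2) ^ 2
  nlinarith [mul_nonneg htr0 (sq_nonneg ‖f ω‖), sq_nonneg (‖f ω‖ ^ 2),
    sq_nonneg (Fintype.card n * RCLike.re (W ω).trace)]

/-- The integral `∫ W^{1/2} f dν`. -/
def weightedIntegral (ν : Measure Ω) (W : Ω → Matrix n n ℂ) (f : Ω → EuclideanSpace ℂ n) :
    EuclideanSpace ℂ n :=
  ∫ ω, toEuclideanLin (CFC.sqrt (W ω)) (f ω) ∂ν

lemma IsMatrixWeight.energyLE_weightedIntegral (hW : IsMatrixWeight ν W) (hf : MemLp f 2 ν) :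
    EnergyLE (matrixIntegral ν W) (weightedIntegral ν W f).ofLp (∫ ω, ‖f ω‖ ^ 2 ∂ν) := by
  intro e
  have hint := hW.integrable_toEuclideanLin_sqrt hf
  have hre : Integrable (fun ω => 2 * RCLike.re (inner ℂ (WithLp.toLp 2 e)
      (toEuclideanLin (CFC.sqrt (W ω)) (f ω)))) ν := (hint.const_inner _).re.const_mul 2
  have hpair : RCLike.re (star e ⬝ᵥ (weightedIntegral ν W f).ofLp) =
      ∫ ω, RCLike.re (inner ℂ (WithLp.toLp 2 e) (toEuclideanLin (CFC.sqrt (W ω)) (f ω))) ∂ν := by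
    rw [dotProduct_comm]
    change RCLike.re (inner ℂ (WithLp.toLp 2 e) (weightedIntegral ν W f)) = _
    rw [weightedIntegral, ← integral_inner hint]
    exact (integral_re (hint.const_inner (𝕜 := ℂ) _)).symm
  rw [hpair, hW.quad_matrixIntegral, ← integral_const_mul,
    ← integral_sub hre (hW.integrable_quad e)]
  refine integral_mono_ae (hre.sub (hW.integrable_quad e))
    (hf.integrable_norm_pow two_ne_zero) ?_
  filter_upwards [hW.nonneg] with ω hω
  exact two_mul_re_inner_sqrt_sub_quad_le hω (WithLp.toLp 2 e) (f ω)

end ComplexWeight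

section Linearization

variable {Ω : Type*} [MeasurableSpace Ω] {ν : Measure Ω} {g : ℕ → Ω → ℝ≥0∞}

lemma lintegral_comp_eq_tsum_setLIntegral {κ : Ω → ℕ} (hκ : Measurable κ) :
    ∫⁻ ω, g (κ ω) ω ∂ν = ∑' k, ∫⁻ ω in κ ⁻¹' {k}, g k ω ∂ν := by
  have hfib (k : ℕ) : MeasurableSet (κ ⁻¹' {k}) := hκ (measurableSet_singleton k)
  calc ∫⁻ ω, g (κ ω) ω ∂ν = ∫⁻ ω in ⋃ k, κ ⁻¹' {k}, g (κ ω) ω ∂ν := by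
        rw [← Set.preimage_iUnion, Set.iUnion_of_singleton, Set.preimage_univ,
          Measure.restrict_univ]
    _ = ∑' k, ∫⁻ ω in κ ⁻¹' {k}, g (κ ω) ω ∂ν :=
        lintegral_iUnion hfib (pairwise_disjoint_fiber κ) _
    _ = ∑' k, ∫⁻ ω in κ ⁻¹' {k}, g k ω ∂ν :=
        tsum_congr fun k => setLIntegral_congr_fun (hfib k) fun ω hω => by
          rw [Set.mem_singleton_iff.mp hω]

lemma exists_measurable_argmax (hg : ∀ k, Measurable (g k)) (N : ℕ) :
    ∃ κ : Ω → ℕ, Measurable κ ∧ ∀ ω, ∀ k ≤ N, g k ω ≤ g (κ ω) ω := by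
  induction N with
  | zero => exact ⟨fun _ => 0, measurable_const, fun ω k hk => by rw [Nat.le_zero.mp hk]⟩
  | succ N ih =>
    obtain ⟨κ, hκ, hmax⟩ := ih
    have hgκ : Measurable fun ω => g (κ ω) ω :=
      (measurable_from_prod_countable_right (f := fun p : ℕ × Ω => g p.1 p.2) hg).comp
        (hκ.prodMk measurable_id)
    refine ⟨fun ω => if g (κ ω) ω ≤ g (N + 1) ω then N + 1 else κ ω,
      .ite (measurableSet_le hgκ (hg _)) measurable_const hκ, fun ω k hk => ?_⟩
    dsimp only
    split_ifs with h
    · rcases Nat.le_succ_iff.mp hk with hk | rfl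
      · exact (hmax ω k hk).trans h
      · exact le_rfl
    · rcases Nat.le_succ_iff.mp hk with hk | rfl
      · exact hmax ω k hk
      · exact (not_le.mp h).le

lemma lintegral_iSup_le_of_forall_measurable (hg : ∀ k, AEMeasurable (g k) ν) {B : ℝ≥0∞}
    (hB : ∀ κ : Ω → ℕ, Measurable κ → ∫⁻ ω, g (κ ω) ω ∂ν ≤ B) :
    ∫⁻ ω, ⨆ k, g k ω ∂ν ≤ B := by
  have hmk : ∀ᵐ ω ∂ν, ∀ k, g k ω = (hg k).mk _ ω := ae_all_iff.mpr fun k => (hg k).ae_eq_mk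
  have hmono : ∀ᵐ ω ∂ν, Monotone fun N => ⨆ k ≤ N, g k ω :=
    ae_of_all _ fun ω _ _ hNM => biSup_mono fun _ hk => hk.trans hNM
  simp only [← biSup_le_eq_iSup (f := fun k => g k _)]
  rw [lintegral_iSup' (fun N => .iSup fun k => .iSup fun _ => hg k) hmono]
  refine iSup_le fun N => ?_
  obtain ⟨κ, hκ, hmax⟩ := exists_measurable_argmax (fun k => (hg k).measurable_mk) N
  refine (lintegral_mono_ae ?_).trans (hB κ hκ)
  filter_upwards [hmk] with ω hω
  refine iSup₂_le fun k hk => ?_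
  rw [hω k, hω (κ ω)]
  exact hmax ω k hk

end Linearization

section Dyadic

lemma measurableSet_dyadic (k j : ℕ) : MeasurableSet (dyadic k j) := measurableSet_Ico

lemma mem_dyadic_iff_floor_eq {k j : ℕ} {x : ℝ} (hx : 0 ≤ x) :
    x ∈ dyadic k j ↔ ⌊x * 2 ^ k⌋₊ = j := by
  rw [Nat.floor_eq_iff (by positivity), dyadic, Set.mem_Ico, div_le_iff₀ (by positivity),
    lt_div_iff₀ (by positivity)]

lemma floor_eq_of_mem_dyadic {k j : ℕ} {x : ℝ} (hx : x ∈ dyadic k j) : ⌊x * 2 ^ k⌋₊ = j :=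
  (mem_dyadic_iff_floor_eq (le_trans (by positivity) hx.1)).mp hx

lemma disjoint_dyadic {k i j : ℕ} (hij : i ≠ j) : Disjoint (dyadic k i) (dyadic k j) :=
  Set.disjoint_left.mpr fun _ hi hj =>
    hij ((floor_eq_of_mem_dyadic hi).symm.trans (floor_eq_of_mem_dyadic hj))

lemma dyadic_eq_union (k j : ℕ) :
    dyadic k j = dyadic (k + 1) (2 * j) ∪ dyadic (k + 1) (2 * j + 1) := by
  have hleft : (j : ℝ) / 2 ^ k = (2 * j : ℕ) / 2 ^ (k + 1) := by
    push_cast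
    field_simp
    ring
  have hmid : ((2 * j : ℕ) + 1 : ℝ) / 2 ^ (k + 1) = (2 * j + 1 : ℕ) / 2 ^ (k + 1) := by
    push_cast
    rfl
  have hright : (j + 1 : ℝ) / 2 ^ k = ((2 * j + 1 : ℕ) + 1) / 2 ^ (k + 1) := by
    push_cast
    field_simp
    ring
  rw [dyadic, dyadic, dyadic, hleft, hright, ← hmid, Set.Ico_union_Ico_eq_Ico]
  · gcongr
    linarith
  · gcongr
    linarith

lemma dyadic_subset {k j : ℕ} (hj : j < 2 ^ k) : dyadic k j ⊆ Set.Ico 0 1 := by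
  refine Set.Ico_subset_Ico (by positivity) ?_
  rw [div_le_one (by positivity)]
  exact_mod_cast hj

lemma restrict_dyadic (ν : Measure ℝ) (k j : ℕ) :
    ν.restrict (dyadic k j) =
      ν.restrict (dyadic (k + 1) (2 * j)) + ν.restrict (dyadic (k + 1) (2 * j + 1)) := by
  rw [dyadic_eq_union, Measure.restrict_union (disjoint_dyadic (by lia)) (measurableSet_dyadic _ _)]

variable {n : Type*} {ν : Measure ℝ}

lemma IsMatrixWeight.isDyadicAdditive_matrixIntegral {W : ℝ → Matrix n n ℂ}
    (hW : IsMatrixWeight ν W) :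
    IsDyadicAdditive fun k j => matrixIntegral (ν.restrict (dyadic k j)) W := fun k j =>
  (congrArg (matrixIntegral · W) (restrict_dyadic ν k j)).trans
    ((hW.restrict _).matrixIntegral_add_measure (hW.restrict _))

lemma isDyadicAdditive_setIntegral {E : Type*} [NormedAddCommGroup E] [NormedSpace ℝ E]
    {g : ℝ → E} (hg : Integrable g ν) :
    IsDyadicAdditive fun k j => ∫ x in dyadic k j, g x ∂ν := fun k j =>
  (congrArg (∫ x, g x ∂·) (restrict_dyadic ν k j)).trans
    (integral_add_measure hg.restrict hg.restrict)

lemma isDyadicAdditive_setLIntegral (ν : Measure ℝ) (g : ℝ → ℝ≥0∞) :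
    IsDyadicAdditive fun k j => ∫⁻ x in dyadic k j, g x ∂ν := fun k j =>
  (congrArg (∫⁻ x, g x ∂·) (restrict_dyadic ν k j)).trans (lintegral_add_measure g _ _)

end Dyadic

section Level

variable {n : Type*} [Fintype n] {ν : Measure ℝ} {W : ℝ → Matrix n n ℂ}

/-- The function equal to `x ↦ ⟨W(x) c, c⟩` on each dyadic interval `dyadic k j`, with
`c = c k j`. -/
def levelQuad (W : ℝ → Matrix n n ℂ) (c : ℕ → ℕ → n → ℂ) (k : ℕ) (x : ℝ) : ℝ≥0∞ :=
  ENNReal.ofReal (quad (W x) (c k ⌊x * 2 ^ k⌋₊))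

lemma IsMatrixWeight.aemeasurable_levelQuad (hW : IsMatrixWeight ν W) (c : ℕ → ℕ → n → ℂ) (k : ℕ) :
    AEMeasurable (levelQuad W c k) ν :=
  (hW.aemeasurable_quad ((measurable_from_nat (f := c k)).comp
    (Nat.measurable_floor.comp (measurable_id.mul_const _)))).ennreal_ofReal

lemma IsMatrixWeight.lintegral_levelQuad (hW : IsMatrixWeight ν W) (c : ℕ → ℕ → n → ℂ) (k : ℕ) :
    ∫⁻ x in dyadic 0 0, levelQuad W c k x ∂ν = ENNReal.ofReal
      (∑ j ∈ Finset.range (2 ^ k), quad (matrixIntegral (ν.restrict (dyadic k j)) W) (c k j)) := by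
  rw [← (isDyadicAdditive_setLIntegral ν (levelQuad W c k)).sum_eq k,
    ENNReal.ofReal_sum_of_nonneg fun j _ => quad_nonneg (hW.restrict _).matrixIntegral_nonneg _]
  refine Finset.sum_congr rfl fun j _ => ?_
  rw [(hW.restrict _).quad_matrixIntegral, ofReal_integral_eq_lintegral_ofReal
    ((hW.restrict _).integrable_quad _) ((hW.restrict _).nonneg.mono fun x hx => quad_nonneg hx _)]
  exact setLIntegral_congr_fun (measurableSet_dyadic k j) fun x hx => by
    rw [levelQuad, floor_eq_of_mem_dyadic hx]

end Level

section Stopping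

variable {d : ℕ} {ν : Measure ℝ} {W : ℝ → Matrix (Fin d) (Fin d) ℂ}
  {f : ℝ → EuclideanSpace ℂ (Fin d)} {κ : ℝ → ℕ}

lemma IsMatrixWeight.carlesonData_stopping (hW : IsMatrixWeight ν W) (hf : MemLp f 2 ν)
    (hκ : Measurable κ) :
    CarlesonData (fun k j => matrixIntegral (ν.restrict (dyadic k j)) W)
      (fun k j => matrixIntegral ((ν.restrict (κ ⁻¹' Set.Ici k)).restrict (dyadic k j)) W)
      (fun k j => matrixIntegral ((ν.restrict (κ ⁻¹' {k})).restrict (dyadic k j)) W)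
      (fun k j => (weightedIntegral (ν.restrict (dyadic k j)) W f).ofLp)
      (fun k j => ∫ x in dyadic k j, ‖f x‖ ^ 2 ∂ν) where
  weight_add := hW.isDyadicAdditive_matrixIntegral
  vec_add k j := congrArg WithLp.ofLp
    (isDyadicAdditive_setIntegral (hW.integrable_toEuclideanLin_sqrt hf) k j)
  energy_add := isDyadicAdditive_setIntegral (hf.integrable_norm_pow two_ne_zero)
  mass_eq k j := by
    have hdisj : Disjoint (κ ⁻¹' Set.Ici (k + 1)) (κ ⁻¹' {k}) :=
      Disjoint.preimage κ (by simp)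
    have hIci : Set.Ici k = Set.Ici (k + 1) ∪ {k} := by
      ext i
      simp only [Set.mem_Ici, Set.mem_union, Set.mem_singleton_iff]
      lia
    rw [← (hW.restrict _).isDyadicAdditive_matrixIntegral k j, hIci, Set.preimage_union,
      Measure.restrict_union hdisj (hκ (measurableSet_singleton k)), Measure.restrict_add,
      ((hW.restrict _).restrict _).matrixIntegral_add_measure ((hW.restrict _).restrict _)]
  node_nonneg k j := ((hW.restrict _).restrict _).matrixIntegral_nonneg
  mass_nonneg k j := ((hW.restrict _).restrict _).matrixIntegral_nonneg
  mass_le k j := by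
    rw [Measure.restrict_comm (measurableSet_dyadic k j)]
    exact (hW.restrict _).matrixIntegral_restrict_le (hκ measurableSet_Ici)
  energyLE k j := (hW.restrict _).energyLE_weightedIntegral (hf.restrict _)

/-- The vector `⟨W⟩_Q⁻¹ ⟨W^{1/2} f⟩_Q` of `Q = dyadic k j`. Integrals may replace the averages, the
factors `ν(Q)⁻¹` cancelling. -/
def coeffVec (ν : Measure ℝ) (W : ℝ → Matrix (Fin d) (Fin d) ℂ)
    (f : ℝ → EuclideanSpace ℂ (Fin d)) (k j : ℕ) : Fin d → ℂ :=
  hermInv (matrixIntegral (ν.restrict (dyadic k j)) W) *ᵥ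
    (weightedIntegral (ν.restrict (dyadic k j)) W f).ofLp

lemma IsMatrixWeight.lintegral_stopped_levelQuad_le (hW : IsMatrixWeight ν W) (hf : MemLp f 2 ν)
    (hκ : Measurable κ) :
    ∫⁻ x in dyadic 0 0, levelQuad W (coeffVec ν W f) (κ x) x ∂ν ≤
      ENNReal.ofReal (carlesonConst d * ∫ x in dyadic 0 0, ‖f x‖ ^ 2 ∂ν) := by
  rw [lintegral_comp_eq_tsum_setLIntegral hκ]
  refine ENNReal.tsum_le_of_sum_range_le fun N => ?_
  calc ∑ k ∈ Finset.range N,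
        ∫⁻ x in κ ⁻¹' {k}, levelQuad W (coeffVec ν W f) k x ∂ν.restrict (dyadic 0 0)
      = ∑ k ∈ Finset.range N, ENNReal.ofReal (∑ j ∈ Finset.range (2 ^ k),
          quad (matrixIntegral ((ν.restrict (κ ⁻¹' {k})).restrict (dyadic k j)) W)
            (coeffVec ν W f k j)) := by
        refine Finset.sum_congr rfl fun k _ => ?_
        rw [Measure.restrict_comm (hκ (measurableSet_singleton k)),
          (hW.restrict _).lintegral_levelQuad]
    _ = ENNReal.ofReal (∑ k ∈ Finset.range N, ∑ j ∈ Finset.range (2 ^ k),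
          quad (matrixIntegral ((ν.restrict (κ ⁻¹' {k})).restrict (dyadic k j)) W)
            (coeffVec ν W f k j)) :=
        (ENNReal.ofReal_sum_of_nonneg fun k _ => Finset.sum_nonneg fun j _ =>
          quad_nonneg ((hW.restrict _).restrict _).matrixIntegral_nonneg _).symm
    _ ≤ ENNReal.ofReal (carlesonConst d * ∫ x in dyadic 0 0, ‖f x‖ ^ 2 ∂ν) :=
        ENNReal.ofReal_le_ofReal ((hW.carlesonData_stopping hf hκ).sum_quad_hermInv_le N)

lemma IsMatrixWeight.lintegral_iSup_levelQuad_le (hW : IsMatrixWeight ν W) (hf : MemLp f 2 ν) :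
    ∫⁻ x in dyadic 0 0, ⨆ k, levelQuad W (coeffVec ν W f) k x ∂ν ≤
      ENNReal.ofReal (carlesonConst d * ∫ x in dyadic 0 0, ‖f x‖ ^ 2 ∂ν) :=
  lintegral_iSup_le_of_forall_measurable (fun k => (hW.restrict _).aemeasurable_levelQuad _ k)
    fun _ hκ => hW.lintegral_stopped_levelQuad_le hf hκ

end Stopping

section Maximal

variable {d : ℕ} {W : ℝ → Matrix (Fin d) (Fin d) ℂ} {f : ℝ → EuclideanSpace ℂ (Fin d)}

lemma IsWeight.isMatrixWeight (hW : IsWeight W) : IsMatrixWeight mu W :=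
  ⟨hW.integrable, hW.posSemidef.mono fun _ hx => hx.nonneg⟩

lemma mu_restrict_dyadic {k j : ℕ} (hj : j < 2 ^ k) :
    mu.restrict (dyadic k j) = volume.restrict (dyadic k j) :=
  Measure.restrict_restrict_of_subset (dyadic_subset hj)

lemma mu_restrict_dyadic_zero : mu.restrict (dyadic 0 0) = mu := by
  simp [mu, dyadic]

lemma IsWeight.hermInv_matrixAvg_mulVec_weightedAvg (hW : IsWeight W) {k j : ℕ}
    (hj : j < 2 ^ k) :
    hermInv (matrixAvg W (dyadic k j)) *ᵥ (weightedAvg W f (dyadic k j)).ofLp =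
      coeffVec mu W f k j := by
  set s : ℝ := (volume.real (dyadic k j))⁻¹
  have hs : s ≠ 0 := by
    have hlt : (j : ℝ) / 2 ^ k < (j + 1) / 2 ^ k := by gcongr; linarith
    rw [ne_eq, inv_eq_zero, dyadic, Real.volume_real_Ico_of_le hlt.le]
    exact (sub_pos.mpr hlt).ne'
  have hmatrix : matrixAvg W (dyadic k j) = s • matrixIntegral (mu.restrict (dyadic k j)) W := by
    ext a b
    rw [mu_restrict_dyadic hj]
    exact setAverage_eq volume (fun x => W x a b) (dyadic k j)
  have hvec : weightedAvg W f (dyadic k j) =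
      s • weightedIntegral (mu.restrict (dyadic k j)) W f := by
    rw [mu_restrict_dyadic hj]
    exact setAverage_eq volume _ (dyadic k j)
  have hself : IsSelfAdjoint (matrixIntegral (mu.restrict (dyadic k j)) W) :=
    .of_nonneg (hW.isMatrixWeight.restrict _).matrixIntegral_nonneg
  rw [hmatrix, hvec, hermInv_smul hself, WithLp.ofLp_smul, mulVec_smul, smul_mulVec, smul_smul,
    mul_inv_cancel₀ hs, one_smul, coeffVec]

lemma IsWeight.enorm_sq_eq_levelQuad (hW : IsWeight W) {k j : ℕ} (hj : j < 2 ^ k) {x : ℝ}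
    (hx : x ∈ dyadic k j) (hWx : 0 ≤ W x) :
    ‖toEuclideanLin (CFC.sqrt (W x) * hermInv (matrixAvg W (dyadic k j)))
      (weightedAvg W f (dyadic k j))‖ₑ ^ 2 = levelQuad W (coeffVec mu W f) k x := by
  have happly : toEuclideanLin (CFC.sqrt (W x) * hermInv (matrixAvg W (dyadic k j)))
      (weightedAvg W f (dyadic k j)) =
      toEuclideanLin (CFC.sqrt (W x)) (WithLp.toLp 2 (coeffVec mu W f k j)) := by
    rw [← hW.hermInv_matrixAvg_mulVec_weightedAvg hj]
    simp only [toLpLin_apply, mulVec_mulVec]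
  rw [happly, levelQuad, floor_eq_of_mem_dyadic hx, ← ofReal_norm,
    ← ENNReal.ofReal_pow (norm_nonneg _), norm_toEuclideanLin_sqrt_sq hWx]

lemma IsWeight.maximal_sq_eq_iSup (hW : IsWeight W) {x : ℝ} (hx : x ∈ Set.Ico 0 1)
    (hWx : 0 ≤ W x) : maximal W f x ^ 2 = ⨆ k, levelQuad W (coeffVec mu W f) k x := by
  rw [maximal, ENNReal.iSup₂_pow_of_ne_zero _ two_ne_zero]
  refine le_antisymm (iSup₂_le ?_) (iSup_le fun k => ?_)
  · rintro _ ⟨⟨k, j, hj, rfl⟩, hxQ⟩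
    rw [hW.enorm_sq_eq_levelQuad hj hxQ hWx]
    exact le_iSup (fun k => levelQuad W (coeffVec mu W f) k x) k
  · have hxk : x ∈ dyadic k ⌊x * 2 ^ k⌋₊ := (mem_dyadic_iff_floor_eq hx.1).mpr rfl
    have hj : ⌊x * 2 ^ k⌋₊ < 2 ^ k := by
      rw [Nat.floor_lt (mul_nonneg hx.1 (by positivity)), Nat.cast_pow, Nat.cast_ofNat]
      exact mul_lt_of_lt_one_left (by positivity) hx.2
    rw [← hW.enorm_sq_eq_levelQuad hj hxk hWx]
    exact le_iSup₂ (f := fun Q (_ : Q ∈ {Q ∈ dyadicIntervals | x ∈ Q}) =>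
      ‖toEuclideanLin (CFC.sqrt (W x) * hermInv (matrixAvg W Q)) (weightedAvg W f Q)‖ₑ ^ 2)
      (dyadic k ⌊x * 2 ^ k⌋₊) ⟨⟨k, _, hj, rfl⟩, hxk⟩

lemma IsWeight.ae_maximal_sq_eq_iSup (hW : IsWeight W) :
    ∀ᵐ x ∂mu, maximal W f x ^ 2 = ⨆ k, levelQuad W (coeffVec mu W f) k x := by
  have hmem : ∀ᵐ x ∂mu, x ∈ Set.Ico (0 : ℝ) 1 := ae_restrict_mem measurableSet_Ico
  filter_upwards [hW.posSemidef, hmem] with x hWx hx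
  exact hW.maximal_sq_eq_iSup hx hWx.nonneg

lemma IsWeight.aemeasurable_maximal_sq (hW : IsWeight W) :
    AEMeasurable (fun x => maximal W f x ^ 2) mu :=
  (AEMeasurable.iSup fun k => hW.isMatrixWeight.aemeasurable_levelQuad _ k).congr <|
    hW.ae_maximal_sq_eq_iSup.mono fun _ => Eq.symm

lemma IsWeight.aemeasurable_maximal (hW : IsWeight W) : AEMeasurable (maximal W f) mu := by
  refine ((hW.aemeasurable_maximal_sq (f := f)).pow_const (2⁻¹ : ℝ)).congr (ae_of_all _ fun x => ?_)
  exact_mod_cast ENNReal.pow_rpow_inv_natCast two_ne_zero _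

lemma eLpNorm_two_sq {Ω E : Type*} [MeasurableSpace Ω] [ENorm E] (ν : Measure Ω) (g : Ω → E) :
    eLpNorm g 2 ν ^ 2 = ∫⁻ ω, ‖g ω‖ₑ ^ 2 ∂ν := by
  simpa using eLpNorm_nnreal_pow_eq_lintegral (f := g) (μ := ν) (p := 2) two_ne_zero

lemma ofReal_integral_norm_sq {Ω E : Type*} [MeasurableSpace Ω] [NormedAddCommGroup E]
    {ν : Measure Ω} {g : Ω → E} (hg : MemLp g 2 ν) :
    ENNReal.ofReal (∫ ω, ‖g ω‖ ^ 2 ∂ν) = eLpNorm g 2 ν ^ 2 := by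
  rw [eLpNorm_two_sq, ofReal_integral_eq_lintegral_ofReal (hg.integrable_norm_pow two_ne_zero)
    (ae_of_all _ fun _ => sq_nonneg _)]
  simp only [ENNReal.ofReal_pow (norm_nonneg _), ofReal_norm]

lemma IsWeight.lintegral_maximal_sq_le (hW : IsWeight W) (hf : MemLp f 2 mu) :
    ∫⁻ x, maximal W f x ^ 2 ∂mu ≤ ENNReal.ofReal (carlesonConst d) * eLpNorm f 2 mu ^ 2 := by
  have h := hW.isMatrixWeight.lintegral_iSup_levelQuad_le hf
  rwa [mu_restrict_dyadic_zero, ENNReal.ofReal_mul (carlesonConst_nonneg d),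
    ofReal_integral_norm_sq hf, ← lintegral_congr_ae hW.ae_maximal_sq_eq_iSup] at h

lemma IsWeight.ae_maximal_lt_top (hW : IsWeight W) (hf : MemLp f 2 mu) :
    ∀ᵐ x ∂mu, maximal W f x < ∞ := by
  have hfin : ENNReal.ofReal (carlesonConst d) * eLpNorm f 2 mu ^ 2 < ∞ :=
    ENNReal.mul_lt_top ENNReal.ofReal_lt_top (ENNReal.pow_lt_top hf.eLpNorm_lt_top)
  filter_upwards [ae_lt_top' hW.aemeasurable_maximal_sq
    ((hW.lintegral_maximal_sq_le hf).trans_lt hfin).ne] with x hx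
  exact (ENNReal.pow_lt_top_iff.mp hx).resolve_right two_ne_zero

lemma IsWeight.eLpNorm_maximal_le (hW : IsWeight W) (hf : MemLp f 2 mu) :
    eLpNorm (maximal W f) 2 mu ≤ (√(carlesonConst d)).toNNReal * eLpNorm f 2 mu := by
  refine (ENNReal.pow_le_pow_left_iff two_ne_zero).mp ?_
  have hconst : ((√(carlesonConst d)).toNNReal : ℝ≥0∞) ^ 2 =
      ENNReal.ofReal (carlesonConst d) := by
    rw [← ENNReal.ofReal, ← ENNReal.ofReal_pow (Real.sqrt_nonneg _),
      Real.sq_sqrt (carlesonConst_nonneg d)]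
  rw [eLpNorm_two_sq, mul_pow, hconst]
  exact hW.lintegral_maximal_sq_le hf

end Maximal

end MatrixWeighted

end

open MatrixWeighted in
theorem theoremt (d : ℕ) :
    ∃ C : ℝ≥0, ∀ W : ℝ → Matrix (Fin d) (Fin d) ℂ, MatrixWeighted.IsWeight W →
      ∀ f : ℝ → EuclideanSpace ℂ (Fin d), MemLp f 2 MatrixWeighted.mu →
        (∀ᵐ x ∂MatrixWeighted.mu, MatrixWeighted.maximal W f x < ∞) ∧
        MemLp (fun x => ((MatrixWeighted.maximal W f x).toReal : ℂ)) 2 MatrixWeighted.mu ∧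
        eLpNorm (fun x => ((MatrixWeighted.maximal W f x).toReal : ℂ)) 2 MatrixWeighted.mu
          ≤ C * eLpNorm f 2 MatrixWeighted.mu := by
  refine ⟨(√(carlesonConst d)).toNNReal, fun W hW f hf => ?_⟩
  have hfin := hW.ae_maximal_lt_top hf
  have hnorm : ∀ᵐ x ∂mu, ‖((maximal W f x).toReal : ℂ)‖ₑ = ‖maximal W f x‖ₑ := by
    filter_upwards [hfin] with x hx
    rw [← ofReal_norm, Complex.norm_real, Real.norm_of_nonneg ENNReal.toReal_nonneg,
      ENNReal.ofReal_toReal hx.ne, enorm_eq_self]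
  have hle : eLpNorm (fun x => ((maximal W f x).toReal : ℂ)) 2 mu ≤
      (√(carlesonConst d)).toNNReal * eLpNorm f 2 mu :=
    (eLpNorm_congr_enorm_ae hnorm).trans_le (hW.eLpNorm_maximal_le hf)
  exact ⟨hfin, ⟨(Complex.measurable_ofReal.comp_aemeasurable
    hW.aemeasurable_maximal.ennreal_toReal).aestronglyMeasurable,
    hle.trans_lt (ENNReal.mul_lt_top ENNReal.coe_lt_top hf.eLpNorm_lt_top)⟩, hle⟩
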